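/- Let $\mathbb H$ be a real separable infinite-dimensional Hilbert space. For a Borel probability measure $P$ on $\mathbb H^2$, the law of a pair $(X,Y)$ with marginal laws $P^X,P^Y$, write $\phi_{X,Y}(w_1,w_2)=\mathbb E\exp(i\langle X,w_1\rangle+i\langle Y,w_2\rangle)$, $\phi_X(w)=\mathbb E\exp(i\langle X,w\rangle)$, $\phi_Y(w)=\mathbb E\exp(i\langle Y,w\rangle)$. Let $\mathcal V$ be the set of symmetric Borel probability measures $\nu$ on $\mathbb H$ with $\operatorname{supp}(\nu)=\mathbb H$, and for $\nu\in\mathcal V$, $\rho>0$ put $$\mathcal F_\nu(\rho)=\Big\{P\in\mathcal P(\mathbb H^2):\int_{\mathbb H^2}|\phi_{X,Y}-\phi_X\otimes\phi_Y|^2\,d(\nu\otimes\nu)\ge\rho\Big\}.$$ A test based on $n$ i.i.d. pairs $\mathcal T_n=\{(X_1,Y_1),\dots,(X_n,Y_n)\}$ with law $P$ is a measurable $\{0,1\}$-valued function $\psi=\psi(\mathcal T_n,\Pi)$, where $\Pi$ is a seed, independent of the data and with a known law (e.g. random permutations, or a constant, in which case $\psi$ is a function of the data only). Let $\Psi(\alpha)$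 be the set of tests with $\mathbb P_P(\psi=1)\le\alpha$ for every $P$ with $P=P^X\otimes P^Y$, and let $$\rho(\psi,\beta)=\inf\Big\{\rho>0:\sup_{\nu\in\mathcal V}\ \sup_{P\in\mathcal F_\nu(\rho)}\mathbb P_P(\psi=0)\le\beta\Big\},\qquad \rho^*(\alpha,\beta)=\inf_{\psi\in\Psi(\alpha)}\rho(\psi,\beta).$$ **Theorem.** Let $\alpha,\beta\in(0,1)$ be fixed with $\alpha+\beta<1$. Then there exist a constant $c>0$ and an integer $N$, independent of $n$ and of the seed, such that $\rho^*(\alpha,\beta)\ge c\,n^{-1/2}$ for all $n\ge N$. -/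

import Mathlib

open MeasureTheory
open scoped ENNReal

noncomputable section

namespace IndepTesting

variable {H : Type*} [NormedAddCommGroup H] [InnerProductSpace ℝ H]
  [MeasurableSpace H] [BorelSpace H]

/-- Joint characteristic functional `φ_{X,Y}(w₁, w₂) = E exp(i⟨X, w₁⟩ + i⟨Y, w₂⟩)` of a law `P`
of `(X, Y)` on `H × H`. -/
def jointCharFun (P : Measure (H × H)) (w₁ w₂ : H) : ℂ :=
  ∫ z, Complex.exp (Complex.I * (inner ℝ z.1 w₁ : ℝ) + Complex.I * (inner ℝ z.2 w₂ : ℝ)) ∂P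

/-- Squared distance covariance `∫ |φ_{X,Y} - φ_X ⊗ φ_Y|² d(ν ⊗ ν)` of a law `P` of `(X, Y)`.
The integrand is continuous and bounded by `4` when `P` is a probability measure. -/
def dCovSq (ν : Measure H) (P : Measure (H × H)) : ℝ :=
  ∫ w, ‖jointCharFun P w.1 w.2 - charFun P.fst w.1 * charFun P.snd w.2‖ ^ 2 ∂(ν.prod ν)

/-- The class `𝒱` of reference measures: symmetric Borel probability measures with full support. -/
def referenceMeasures (H : Type*) [NormedAddCommGroup H] [MeasurableSpace H] :
    Set (Measure H) :=
  {ν | IsProbabilityMeasure ν ∧ (∀ B, MeasurableSet B → ν ((fun x => -x) ⁻¹' B) = ν B) ∧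
    ν.support = Set.univ}

/-- The null hypothesis: laws of `(X, Y)` with `X` and `Y` independent. -/
def nullLaws (H : Type*) [MeasurableSpace H] : Set (Measure (H × H)) :=
  {P | IsProbabilityMeasure P ∧ P = P.fst.prod P.snd}

/-- The local alternatives `ℱ_ν(ρ)`: laws whose squared distance covariance is at least `ρ`. -/
def alternatives (ν : Measure H) (ρ : ℝ) : Set (Measure (H × H)) :=
  {P | IsProbabilityMeasure P ∧ ρ ≤ dCovSq ν P}

/-- A `{0,1}`-valued measurable test based on `n` pairs and a seed in `U` (for instance the random
permutations of a permutation test). For a one-point `U` it is a function of the data alone. -/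
structure Test (H : Type*) [MeasurableSpace H] (n : ℕ) (U : Type*) [MeasurableSpace U] where
  decision : (Fin n → H × H) × U → Fin 2
  measurable_decision : Measurable decision

/-- Joint law of `n` i.i.d. pairs with law `P` and an independent seed with law `κ`. -/
def sampleLaw {U : Type*} [MeasurableSpace U] (n : ℕ) (P : Measure (H × H)) (κ : Measure U) :
    Measure ((Fin n → H × H) × U) :=
  (Measure.pi fun _ : Fin n => P).prod κ

/-- `Ψ(α)`: tests whose type I error is at most `α` uniformly over the null hypothesis. -/
def levelTests (H : Type*) [NormedAddCommGroup H] [MeasurableSpace H]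
    {U : Type*} [MeasurableSpace U] (n : ℕ) (κ : Measure U) (α : ℝ) : Set (Test H n U) :=
  {ψ | ⨆ P ∈ nullLaws H, sampleLaw n P κ {ω | ψ.decision ω = 1} ≤ ENNReal.ofReal α}

/-- The largest type II error of `ψ` over all `ν ∈ 𝒱` and all laws in `ℱ_ν(ρ)`. -/
def maxTypeTwoError {U : Type*} [MeasurableSpace U] {n : ℕ} (κ : Measure U) (ψ : Test H n U)
    (ρ : ℝ) : ℝ≥0∞ :=
  ⨆ ν ∈ referenceMeasures H, ⨆ P ∈ alternatives ν ρ, sampleLaw n P κ {ω | ψ.decision ω = 0}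

/-- Uniform separation rate `ρ(ψ, β)`, an infimum taken in `[0, ∞]`. -/
def separationRate {U : Type*} [MeasurableSpace U] {n : ℕ} (κ : Measure U) (ψ : Test H n U)
    (β : ℝ) : ℝ≥0∞ :=
  ⨅ (ρ : ℝ) (_ : 0 < ρ ∧ maxTypeTwoError κ ψ ρ ≤ ENNReal.ofReal β), ENNReal.ofReal ρ

/-- Minimax separation rate `ρ*(α, β) = inf_{ψ ∈ Ψ(α)} ρ(ψ, β)` for sample size `n`. -/
def minimaxRate (H : Type*) [NormedAddCommGroup H] [InnerProductSpace ℝ H]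
    [MeasurableSpace H] [BorelSpace H] {U : Type*} [MeasurableSpace U]
    (n : ℕ) (κ : Measure U) (α β : ℝ) : ℝ≥0∞ :=
  ⨅ ψ ∈ levelTests H n κ α, separationRate κ ψ β

end IndepTesting

end

/-!
The class `𝒱` of reference measures is so rich that the minimax rate does not tend to zero at all:
it is at least `1 / 4` for every sample size, and `n ^ (-1 / 2) ≤ 1` gives the claim.

Take orthonormal vectors `vₐ`, for `a` in a finite set of `M` places, and `v∗`. For a labelling
`b` of the places by signs let `P_b` be the law of `(s vₐ, s b(a) v∗)`, where `a` is a uniform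
place and `s` an independent uniform sign (`labelledLaw`). Both marginals are independent of `b`,
and their product is the law of `(s vₐ, t v∗)` with a further independent sign `t`
(`independentLaw`).

* Each `P_b` is a distant alternative for a reference measure that depends on `b`. Let `w` be the
  vector with `⟪vₐ, w⟫ = b(a) π / 2` and `⟪v∗, w⟫ = π / 2`. At the four points `(±w, ±w)` the joint
  characteristic functional is `±1` while that of the first marginal vanishes, and some symmetric
  measure of full support gives mass at least `1 / 2` to `{w, -w}`. Hence the squared distance
  covariance is at least `1 / 4` (`exists_labelledLaw_mem_alternatives`).
* For a uniformly random `b`, a sample of size `n` from `P_b` cannot be told from an independent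
  one: as long as the sampled places are distinct, the labels read at them are independent uniform
  signs (`expect_comp_of_injective`). So the mixture of the `P_b`-samples dominates the null sample
  up to the probability of a repeated place (`expect_le_expect_labels_add`), which tends to zero as
  `M → ∞` with `n` fixed (`exists_collision_lt`). The seed plays no role in this comparison.

A test of level `α` accepts the null sample with probability at least `1 - α`. If it had second
kind error at most `β` at separation below `1 / 4`, it would accept each `P_b`-sample with
probability at most `β`, which contradicts `α + β < 1` for large `M`.
-/

noncomputable section

namespace IndepTesting

open ProbabilityTheory Function
open scoped BigOperators

/-! ### Uniform laws on finitely many points -/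

section UniformLaw

variable {ι κ E F : Type*} [MeasurableSpace ι] [MeasurableSpace κ] [MeasurableSpace E]
  [MeasurableSpace F]

/-- The law of `x i` for `i` drawn uniformly from the finite type `ι`. -/
def uniformLaw (x : ι → E) : Measure E :=
  (uniformOn (Set.univ : Set ι)).map x

variable [DiscreteMeasurableSpace ι]


lemma fst_uniformLaw (x : ι → E × F) : (uniformLaw x).fst = uniformLaw fun i => (x i).1 :=
  Measure.map_map measurable_fst .of_discrete

variable [Fintype ι] [Fintype κ] [DiscreteMeasurableSpace κ]

lemma uniformOn_univ_singleton (i : ι) :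
    uniformOn (Set.univ : Set ι) {i} = (Fintype.card ι : ℝ≥0∞)⁻¹ := by
  rw [uniformOn_univ, Measure.count_singleton, one_div]

instance isProbabilityMeasure_uniformLaw [Nonempty ι] (x : ι → E) :
    IsProbabilityMeasure (uniformLaw x) := by
  have := isProbabilityMeasure_uniformOn (Set.finite_univ (α := ι)) Set.univ_nonempty
  exact Measure.isProbabilityMeasure_map Measurable.of_discrete.aemeasurable

lemma integral_uniformLaw [Nonempty ι] {𝕜 : Type*} [RCLike 𝕜] (x : ι → E) {f : E → 𝕜}
    (hf : StronglyMeasurable f) : ∫ z, f z ∂(uniformLaw x) = 𝔼 i, f (x i) := by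
  have := isProbabilityMeasure_uniformOn (Set.finite_univ (α := ι)) Set.univ_nonempty
  rw [uniformLaw, integral_map Measurable.of_discrete.aemeasurable hf.aestronglyMeasurable,
    integral_fintype .of_finite, Fintype.expect_eq_sum_div_card, Finset.sum_div]
  refine Finset.sum_congr rfl fun i _ => ?_
  rw [measureReal_def, uniformOn_univ_singleton, ENNReal.toReal_inv, ENNReal.toReal_natCast,
    RCLike.real_smul_eq_coe_mul, div_eq_inv_mul]
  push_cast
  rfl

lemma prod_uniformLaw [Nonempty ι] [Nonempty κ] (x : ι → E) (y : κ → F) :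
    (uniformLaw x).prod (uniformLaw y) = uniformLaw fun p : ι × κ => (x p.1, y p.2) := by
  have := isProbabilityMeasure_uniformOn (Set.finite_univ (α := ι)) Set.univ_nonempty
  have := isProbabilityMeasure_uniformOn (Set.finite_univ (α := κ)) Set.univ_nonempty
  have h : (uniformOn (Set.univ : Set ι)).prod (uniformOn (Set.univ : Set κ))
      = uniformOn Set.univ := by
    refine Measure.ext_of_singleton fun p => ?_
    rw [← Set.singleton_prod_singleton, Measure.prod_prod, Set.singleton_prod_singleton,
      uniformOn_univ_singleton, uniformOn_univ_singleton, uniformOn_univ_singleton,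
      Fintype.card_prod, Nat.cast_mul, ENNReal.mul_inv (by simp) (by simp)]
  rw [uniformLaw, uniformLaw, Measure.map_prod_map _ _ .of_discrete .of_discrete, h]
  rfl

lemma pi_uniformLaw [Nonempty ι] (n : ℕ) (x : ι → E) :
    (Measure.pi fun _ : Fin n => uniformLaw x)
      = uniformLaw fun (ω : Fin n → ι) (k : Fin n) => x (ω k) := by
  have := isProbabilityMeasure_uniformOn (Set.finite_univ (α := ι)) Set.univ_nonempty
  have h : (Measure.pi fun _ : Fin n => uniformOn (Set.univ : Set ι))
      = uniformOn Set.univ := by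
    refine Measure.ext_of_singleton fun p => ?_
    rw [Measure.pi_singleton, uniformOn_univ_singleton]
    simp only [uniformOn_univ_singleton, Finset.prod_const, Finset.card_univ, Fintype.card_fin,
      Fintype.card_fun, Nat.cast_pow, ENNReal.inv_pow]
  unfold uniformLaw
  rw [← h, Measure.pi_map_pi fun _ => Measurable.of_discrete.aemeasurable]

end UniformLaw

/-! ### Random labels and repeated places -/

section Collisions

variable {α A : Type*} [Fintype α] [Fintype A]

/-- Random labels read at distinct places are independent and uniform. -/
lemma expect_comp_of_injective [DecidableEq α] [CommGroup A] {n : ℕ} {m : Fin n → α}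
    (hm : Injective m) (G : (Fin n → A) → ℝ) : 𝔼 b : α → A, G (b ∘ m) = 𝔼 t, G t := by
  -- Multiplying `b` by any labelling that extends `c` along `m` leaves the average unchanged.
  have key : ∀ c : Fin n → A, 𝔼 b : α → A, G (b ∘ m) = 𝔼 b : α → A, G ((b ∘ m) * c) := by
    intro c
    refine (Fintype.expect_equiv (Equiv.mulRight (extend m c 1)) _ _ fun b => ?_).symm
    congr 1
    ext k
    simp [hm.extend_apply]
  calc 𝔼 b : α → A, G (b ∘ m) = 𝔼 c : Fin n → A, 𝔼 b : α → A, G ((b ∘ m) * c) := by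
        rw [← Fintype.expect_const (ι := Fin n → A) (𝔼 b : α → A, G (b ∘ m))]
        exact Finset.expect_congr rfl fun c _ => key c
    _ = 𝔼 b : α → A, 𝔼 t : Fin n → A, G t := by
        rw [Finset.expect_comm]
        exact Finset.expect_congr rfl fun b _ =>
          Fintype.expect_equiv (Equiv.mulLeft (b ∘ m)) _ _ fun c => rfl
    _ = _ := Fintype.expect_const _

lemma expect_arrow_prod {β : Type*} [Fintype β] {n : ℕ} (G : (Fin n → α × β) → ℝ) :
    𝔼 ω, G ω = 𝔼 m : Fin n → α, 𝔼 s : Fin n → β, G fun k => (m k, s k) := by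
  rw [← Finset.expect_product' Finset.univ Finset.univ
    fun (m : Fin n → α) (s : Fin n → β) => G fun k => (m k, s k)]
  exact Fintype.expect_equiv (Equiv.arrowProdEquivProdArrow (Fin n) (fun _ => α)
    (fun _ => β)) _ _ fun _ => rfl

open scoped Classical in
lemma expect_not_injective [Nonempty α] (n : ℕ) :
    𝔼 m : Fin n → α, (if Injective m then (0 : ℝ) else 1)
      = 1 - (Fintype.card α).descFactorial n / (Fintype.card α : ℝ) ^ n := by
  have h1 : ∀ m : Fin n → α, (if Injective m then (0 : ℝ) else 1)
      = 1 - if Injective m then (1 : ℝ) else 0 := by intro m; split_ifs <;> simp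
  simp_rw [h1]
  rw [Finset.expect_sub_distrib, Fintype.expect_const, Fintype.expect_eq_sum_div_card,
    Finset.sum_boole, ← Fintype.card_subtype,
    Fintype.card_congr (Equiv.subtypeInjectiveEquivEmbedding (Fin n) α),
    Fintype.card_embedding_eq]
  simp

/-- Replacing an independent second label by `s * b m`, for a random labelling `b` of the places,
lowers the mean of a `[0, 1]`-valued statistic by at most the probability of drawing some place
twice. -/
lemma expect_le_expect_labels_add [Nonempty α] [DecidableEq α] [CommGroup A] {n : ℕ}
    (Φ : (Fin n → α × A × A) → ℝ) (h0 : ∀ ω, 0 ≤ Φ ω) (h1 : ∀ ω, Φ ω ≤ 1) :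
    𝔼 ω, Φ ω ≤ (𝔼 b : α → A, 𝔼 ω : Fin n → α × A,
        Φ fun k => ((ω k).1, (ω k).2, (ω k).2 * b (ω k).1))
      + (1 - (Fintype.card α).descFactorial n / (Fintype.card α : ℝ) ^ n) := by
  classical
  have e1 : 𝔼 ω, Φ ω = 𝔼 m : Fin n → α, 𝔼 s : Fin n → A, 𝔼 t : Fin n → A,
      Φ fun k => (m k, s k, t k) := by
    rw [expect_arrow_prod]
    exact Finset.expect_congr rfl fun m _ => expect_arrow_prod _
  have e2 : (𝔼 b : α → A, 𝔼 ω : Fin n → α × A,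
        Φ fun k => ((ω k).1, (ω k).2, (ω k).2 * b (ω k).1))
      = 𝔼 m : Fin n → α, 𝔼 s : Fin n → A, 𝔼 b : α → A,
      Φ fun k => (m k, s k, s k * b (m k)) := by
    rw [Finset.expect_comm]
    exact expect_arrow_prod _
  rw [e1, e2, ← expect_not_injective, ← Finset.expect_add_distrib]
  refine Finset.expect_le_expect fun m _ => ?_
  split_ifs with hm
  · rw [add_zero]
    refine (Finset.expect_congr rfl fun s _ => ?_).le
    rw [← Fintype.expect_equiv (Equiv.mulLeft s) (fun t => Φ fun k => (m k, s k, s k * t k))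
      _ fun _ => rfl]
    exact (expect_comp_of_injective hm fun t => Φ fun k => (m k, s k, s k * t k)).symm
  · have u : (𝔼 s : Fin n → A, 𝔼 t : Fin n → A, Φ fun k => (m k, s k, t k)) ≤ 1 :=
      Finset.expect_le Finset.univ_nonempty fun s _ =>
        Finset.expect_le Finset.univ_nonempty fun t _ => h1 _
    have l : 0 ≤ 𝔼 s : Fin n → A, 𝔼 b : α → A, Φ fun k => (m k, s k, s k * b (m k)) :=
      Finset.expect_nonneg fun s _ => Finset.expect_nonneg fun t _ => h0 _
    linarith

lemma exists_collision_lt (n : ℕ) {δ : ℝ} (hδ : 0 < δ) :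
    ∃ M : ℕ, 0 < M ∧ 1 - (M.descFactorial n : ℝ) / (M : ℝ) ^ n < δ := by
  have h := (Asymptotics.isEquivalent_iff_tendsto_one ?_).1 (isEquivalent_descFactorial n)
  · obtain ⟨M, hM, hpos⟩ := ((h.eventually (lt_mem_nhds (show 1 - δ < 1 by linarith))).and
      (Filter.eventually_gt_atTop 0)).exists
    refine ⟨M, hpos, ?_⟩
    simp only [Pi.div_apply] at hM
    linarith
  · filter_upwards [Filter.eventually_gt_atTop 0] with M hM
    positivity

end Collisions

/-! ### Symmetric measures of full support -/

section ReferenceMeasure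

variable {H : Type*} [NormedAddCommGroup H] [MeasurableSpace H] [BorelSpace H]

/-- A probability measure of full support: random points of a dense sequence. -/
lemma exists_isProbabilityMeasure_isOpenPosMeasure [TopologicalSpace.SeparableSpace H] :
    ∃ μ : Measure H, IsProbabilityMeasure μ ∧ μ.IsOpenPosMeasure := by
  refine ⟨(poissonMeasure 1).map (TopologicalSpace.denseSeq H),
    Measure.isProbabilityMeasure_map Measurable.of_discrete.aemeasurable, ⟨?_⟩⟩
  intro O hO hne
  obtain ⟨k, hk⟩ := (TopologicalSpace.denseRange_denseSeq H).exists_mem_open hO hne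
  rw [Measure.map_apply .of_discrete hO.measurableSet]
  have hsub : {k} ⊆ TopologicalSpace.denseSeq H ⁻¹' O := Set.singleton_subset_iff.2 hk
  refine (lt_of_lt_of_le ?_ (measure_mono hsub)).ne'
  -- The Poisson law serves only as a law on `ℕ` that charges every point.
  rw [poissonMeasure_singleton, ENNReal.ofReal_pos]
  positivity

/-- A symmetric measure of full support may put mass `1/2` on any prescribed pair `{w, -w}`. -/
lemma exists_referenceMeasure_pair [TopologicalSpace.SeparableSpace H] (w : H) :
    ∃ ν ∈ referenceMeasures H, 1 / 2 ≤ ν.real {w, -w} := by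
  obtain ⟨μ, hμ, hpos⟩ := exists_isProbabilityMeasure_isOpenPosMeasure (H := H)
  set μ' : Measure H := (2⁻¹ : ℝ≥0∞) • (Measure.dirac w + μ) with hμ'
  have hneg : Measurable fun x : H => -x := continuous_neg.measurable
  have hp' : IsProbabilityMeasure μ' := ⟨by
    rw [hμ', Measure.smul_apply, Measure.add_apply, measure_univ, measure_univ,
      one_add_one_eq_two, smul_eq_mul, ENNReal.inv_mul_cancel two_ne_zero ENNReal.ofNat_ne_top]⟩
  have hmap : IsProbabilityMeasure (μ'.map fun x => -x) :=
    Measure.isProbabilityMeasure_map hneg.aemeasurable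
  have hp : IsProbabilityMeasure ((2⁻¹ : ℝ≥0∞) • (μ' + μ'.map fun x => -x)) := ⟨by
    rw [Measure.smul_apply, Measure.add_apply, measure_univ, measure_univ, one_add_one_eq_two,
      smul_eq_mul, ENNReal.inv_mul_cancel two_ne_zero ENNReal.ofNat_ne_top]⟩
  have hS : MeasurableSet ({w, -w} : Set H) := ((Set.finite_singleton _).insert _).measurableSet
  have hle : (2⁻¹ : ℝ≥0∞) ≤ μ' {w, -w} := by
    rw [hμ', Measure.smul_apply, Measure.add_apply, Measure.dirac_apply' _ hS]
    simp [mul_add]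
  have hSneg : (fun x : H => -x) ⁻¹' {w, -w} = {w, -w} := by
    ext x
    simp [or_comm]
  refine ⟨(2⁻¹ : ℝ≥0∞) • (μ' + μ'.map fun x => -x), ⟨hp, fun B hB => ?_, ?_⟩, ?_⟩
  · simp only [Measure.smul_apply, Measure.add_apply]
    rw [Measure.map_apply hneg (hneg hB), Measure.map_apply hneg hB, ← Set.preimage_comp,
      add_comm]
    congr 3
    ext x
    simp
  · refine Set.eq_univ_of_forall fun x => ?_
    rw [Measure.mem_support_iff_forall]
    intro O hO
    have := Measure.measure_pos_of_mem_nhds μ hO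
    simp [hμ', this]
  · have h2 : (2⁻¹ : ℝ≥0∞) ≤ ((2⁻¹ : ℝ≥0∞) • (μ' + μ'.map fun x => -x)) {w, -w} := by
      rw [Measure.smul_apply, Measure.add_apply, Measure.map_apply hneg hS, hSneg, ← two_mul,
        smul_eq_mul, ← mul_assoc, ENNReal.inv_mul_cancel two_ne_zero ENNReal.ofNat_ne_top,
        one_mul]
      exact hle
    have := ENNReal.toReal_mono (measure_ne_top _ _) h2
    simpa [measureReal_def] using this

end ReferenceMeasure

/-! ### A lower bound for the distance covariance -/

section DistanceCovariance

variable {H : Type*} [NormedAddCommGroup H] [InnerProductSpace ℝ H] [MeasurableSpace H]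

lemma norm_jointCharFun_le_one (P : Measure (H × H)) [IsProbabilityMeasure P] (w₁ w₂ : H) :
    ‖jointCharFun P w₁ w₂‖ ≤ 1 := by
  refine (norm_integral_le_of_norm_le_const (C := 1) (ae_of_all _ fun z => ?_)).trans (by simp)
  rw [← mul_add, ← Complex.ofReal_add, mul_comm, Complex.norm_exp_ofReal_mul_I]

/-- A lower bound for the distance covariance: only the mass of `ν` on a set where the two functionals differ
by at least `1` is used. -/
lemma sq_measureReal_le_dCovSq [BorelSpace H] [SecondCountableTopology H] (ν : Measure H)
    [IsProbabilityMeasure ν] (P : Measure (H × H)) [IsProbabilityMeasure P] {S : Set H}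
    (hS : MeasurableSet S)
    (h : ∀ w₁ ∈ S, ∀ w₂ ∈ S, 1 ≤ ‖jointCharFun P w₁ w₂ - charFun P.fst w₁ * charFun P.snd w₂‖) :
    ν.real S ^ 2 ≤ dCovSq ν P := by
  set Δ : H × H → ℂ := fun w => jointCharFun P w.1 w.2 - charFun P.fst w.1 * charFun P.snd w.2
    with hΔ
  have hj : StronglyMeasurable fun w : H × H => jointCharFun P w.1 w.2 := by
    unfold jointCharFun
    refine StronglyMeasurable.integral_prod_right' (f := fun p : (H × H) × (H × H) =>
      Complex.exp (Complex.I * (inner ℝ p.2.1 p.1.1 : ℝ)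
        + Complex.I * (inner ℝ p.2.2 p.1.2 : ℝ))) ?_
    exact Continuous.stronglyMeasurable (by fun_prop)
  have hm : StronglyMeasurable Δ :=
    hj.sub ((stronglyMeasurable_charFun.comp_measurable measurable_fst).mul
      (stronglyMeasurable_charFun.comp_measurable measurable_snd))
  have hb : ∀ w, ‖Δ w‖ ≤ 2 := fun w => by
    refine (norm_sub_le _ _).trans ?_
    have h1 := norm_jointCharFun_le_one P w.1 w.2
    have h2 : ‖charFun P.fst w.1 * charFun P.snd w.2‖ ≤ 1 := by
      rw [norm_mul]
      exact mul_le_one₀ (norm_charFun_le_one _) (norm_nonneg _) (norm_charFun_le_one _)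
    linarith
  have hint : Integrable (fun w => ‖Δ w‖ ^ 2) (ν.prod ν) := by
    refine Integrable.of_bound (hm.norm.pow 2).aestronglyMeasurable 4 (ae_of_all _ fun w => ?_)
    rw [Real.norm_of_nonneg (by positivity)]
    nlinarith [hb w, norm_nonneg (Δ w)]
  calc ν.real S ^ 2 = ∫ w, (S ×ˢ S).indicator 1 w ∂(ν.prod ν) := by
        rw [integral_indicator_one (hS.prod hS), measureReal_prod_prod, sq]
    _ ≤ ∫ w, ‖Δ w‖ ^ 2 ∂(ν.prod ν) := by
        refine integral_mono ((integrable_const 1).indicator (hS.prod hS)) hint fun w => ?_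
        by_cases hw : w ∈ S ×ˢ S
        · simpa [hw] using one_le_pow₀ (n := 2) (h w.1 hw.1 w.2 hw.2)
        · simp [hw]
    _ = dCovSq ν P := rfl

end DistanceCovariance

/-! ### Signs -/

section Signs

instance discreteMeasurableSpace_units_int : DiscreteMeasurableSpace ℤˣ :=
  ⟨fun s => ⟨Units.val '' s, MeasurableSet.of_discrete,
    Set.preimage_image_eq s Units.val_injective⟩⟩

/-- A sign as a real number. -/
def sgn (s : ℤˣ) : ℝ := ((s : ℤ) : ℝ)

lemma sgn_mul (s t : ℤˣ) : sgn (s * t) = sgn s * sgn t := by simp [sgn]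

lemma exp_I_mul_sgn (s : ℤˣ) :
    Complex.exp (Complex.I * ((sgn s * (Real.pi / 2) : ℝ) : ℂ)) = sgn s * Complex.I := by
  obtain rfl | rfl := Int.units_eq_one_or s
  · rw [mul_comm]
    simp [sgn, Complex.exp_pi_div_two_mul_I]
  · rw [mul_comm]
    simp [sgn, Complex.exp_neg, Complex.exp_pi_div_two_mul_I]

lemma norm_sgn (s : ℤˣ) : ‖((sgn s : ℝ) : ℂ)‖ = 1 := by
  obtain rfl | rfl := Int.units_eq_one_or s <;> simp [sgn]

lemma sgn_mul_self (s : ℤˣ) : sgn s * sgn s = 1 := by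
  obtain rfl | rfl := Int.units_eq_one_or s <;> simp [sgn]

end Signs

/-! ### Laws with hidden labels -/

section HiddenLabels

variable {H : Type*} [NormedAddCommGroup H] [InnerProductSpace ℝ H]
  {α : Type*}

lemma exists_orthonormal_nat [CompleteSpace H] (hdim : ¬ FiniteDimensional ℝ H) :
    ∃ v : ℕ → H, Orthonormal ℝ v := by
  obtain ⟨w, b, hb⟩ := exists_hilbertBasis ℝ H
  have hw : Infinite w := by
    by_contra hfin
    have : Finite w := not_infinite_iff_finite.1 hfin
    have hfd : FiniteDimensional ℝ (Submodule.span ℝ (Set.range b)) :=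
      FiniteDimensional.span_of_finite ℝ (Set.finite_range b)
    have h := b.dense_span
    rw [(Submodule.closed_of_finiteDimensional _).submodule_topologicalClosure_eq] at h
    rw [h] at hfd
    exact hdim (Module.finite_def.2 (Module.Finite.iff_fg.1 hfd))
  exact ⟨b ∘ Infinite.natEmbedding w, b.orthonormal.comp _ (Infinite.natEmbedding w).injective⟩

/-- The point `(s vₐ, t v∗)` of `H × H`, for a place `a` and signs `s`, `t`; here `v∗` is the
member of `v` indexed by `none`. -/
def signedPair (v : Option α → H) (p : α × ℤˣ × ℤˣ) : H × H :=
  (sgn p.2.1 • v (some p.1), sgn p.2.2 • v none)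

/-- A point `w` with `⟪vₐ, w⟫ = b a * π / 2` for every place `a` and `⟪v∗, w⟫ = π / 2`. -/
def labelDirection [Fintype α] (v : Option α → H) (b : α → ℤˣ) : H :=
  ∑ o, (o.elim 1 (fun a => sgn (b a)) * (Real.pi / 2)) • v o

lemma inner_labelDirection [Fintype α] {v : Option α → H} (hv : Orthonormal ℝ v) (b : α → ℤˣ)
    (o : Option α) : inner ℝ (v o) (labelDirection v b)
      = o.elim 1 (fun a => sgn (b a)) * (Real.pi / 2) :=
  hv.inner_right_fintype _ o

variable [MeasurableSpace H] [MeasurableSpace α]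

/-- The law of `(s vₐ, t v∗)` for a uniform place `a` and independent uniform signs `s`, `t`. -/
def independentLaw (v : Option α → H) : Measure (H × H) :=
  uniformLaw (signedPair v)

/-- The law of `(s vₐ, s b(a) v∗)` for a uniform place `a` and an independent uniform sign `s`. -/
def labelledLaw (v : Option α → H) (b : α → ℤˣ) : Measure (H × H) :=
  uniformLaw fun p : α × ℤˣ => signedPair v (p.1, p.2, p.2 * b p.1)

variable [Fintype α] [Nonempty α] [DiscreteMeasurableSpace α]

lemma independentLaw_mem_nullLaws (v : Option α → H) : independentLaw v ∈ nullLaws H := by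
  refine ⟨isProbabilityMeasure_uniformLaw _, ?_⟩
  have h : independentLaw v
      = (uniformLaw fun q : α × ℤˣ => sgn q.2 • v (some q.1)).prod
        (uniformLaw fun t : ℤˣ => sgn t • v none) := by
    rw [prod_uniformLaw]
    unfold independentLaw uniformLaw
    -- `signedPair` is indexed by `α × (ℤˣ × ℤˣ)`, the product of the two laws by `(α × ℤˣ) × ℤˣ`.
    have hassoc : (uniformOn (Set.univ : Set (α × ℤˣ × ℤˣ)))
        = (uniformOn (Set.univ : Set ((α × ℤˣ) × ℤˣ))).map (Equiv.prodAssoc α ℤˣ ℤˣ) := by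
      refine Measure.ext_of_singleton fun p => ?_
      rw [Measure.map_apply .of_discrete (measurableSet_singleton p),
        ← Equiv.image_symm_eq_preimage, Set.image_singleton, uniformOn_univ_singleton,
        uniformOn_univ_singleton, Fintype.card_congr (Equiv.prodAssoc α ℤˣ ℤˣ)]
    rw [hassoc, Measure.map_map .of_discrete .of_discrete]
    rfl
  rw [h, Measure.fst_prod, Measure.snd_prod]

variable [BorelSpace H]

/-- On `± labelDirection v b` the pairing with `s vₐ` is a uniform sign times `π / 2`, so its
exponential is `± I` with equal weights. -/
lemma charFun_fst_labelledLaw {v : Option α → H} (hv : Orthonormal ℝ v) (b : α → ℤˣ)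
    (σ : ℤˣ) : charFun (labelledLaw v b).fst (sgn σ • labelDirection v b) = 0 := by
  rw [labelledLaw, fst_uniformLaw, charFun_apply,
    integral_uniformLaw _ (Continuous.stronglyMeasurable (by fun_prop))]
  have hterm : ∀ p : α × ℤˣ, Complex.exp ((inner ℝ
      (signedPair v (p.1, p.2, p.2 * b p.1)).1 (sgn σ • labelDirection v b) : ℝ) * Complex.I)
      = sgn (σ * p.2 * b p.1) * Complex.I := by
    intro p
    rw [← exp_I_mul_sgn, mul_comm, signedPair, real_inner_smul_left, real_inner_smul_right,
      inner_labelDirection hv, sgn_mul, sgn_mul]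
    congr 3
    simp only [Option.elim]
    ring
  simp_rw [hterm]
  -- Flipping the sign `s` changes the sign of the average.
  refine self_eq_neg.1 ?_
  rw [← Finset.expect_neg_distrib]
  refine Fintype.expect_equiv (Equiv.prodCongr (Equiv.refl α) (Equiv.neg ℤˣ)) _ _ fun p => ?_
  simp [sgn]

/-- On `± labelDirection v b` the two pairings are the same random sign times `± π / 2`, so the
product of the exponentials is a deterministic sign. -/
lemma norm_jointCharFun_labelledLaw [SecondCountableTopology H] {v : Option α → H}
    (hv : Orthonormal ℝ v) (b : α → ℤˣ)
    (σ τ : ℤˣ) : ‖jointCharFun (labelledLaw v b) (sgn σ • labelDirection v b)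
      (sgn τ • labelDirection v b)‖ = 1 := by
  rw [labelledLaw, jointCharFun,
    integral_uniformLaw _ (Continuous.stronglyMeasurable (by fun_prop))]
  have hterm : ∀ p : α × ℤˣ, Complex.exp (Complex.I * (inner ℝ
        (signedPair v (p.1, p.2, p.2 * b p.1)).1 (sgn σ • labelDirection v b) : ℝ)
      + Complex.I * (inner ℝ
        (signedPair v (p.1, p.2, p.2 * b p.1)).2 (sgn τ • labelDirection v b) : ℝ))
      = - (sgn (σ * τ) : ℂ) := by
    intro p
    have h1 : inner ℝ (signedPair v (p.1, p.2, p.2 * b p.1)).1 (sgn σ • labelDirection v b)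
        = sgn (σ * (p.2 * b p.1)) * (Real.pi / 2) := by
      rw [signedPair, real_inner_smul_left, real_inner_smul_right, inner_labelDirection hv,
        sgn_mul, sgn_mul]
      simp only [Option.elim]
      ring
    have h2 : inner ℝ (signedPair v (p.1, p.2, p.2 * b p.1)).2 (sgn τ • labelDirection v b)
        = sgn (τ * (p.2 * b p.1)) * (Real.pi / 2) := by
      rw [signedPair, real_inner_smul_left, real_inner_smul_right, inner_labelDirection hv,
        sgn_mul τ]
      simp only [Option.elim]
      ring
    rw [h1, h2, Complex.exp_add, exp_I_mul_sgn, exp_I_mul_sgn, sgn_mul σ, sgn_mul τ, sgn_mul σ]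
    have hs : (sgn (p.2 * b p.1) : ℂ) * sgn (p.2 * b p.1) = 1 := by
      exact_mod_cast sgn_mul_self (p.2 * b p.1)
    push_cast
    linear_combination (-(sgn σ * sgn τ : ℂ)) * hs + (sgn σ * sgn τ : ℂ)
      * (sgn (p.2 * b p.1) : ℂ) * sgn (p.2 * b p.1) * Complex.I_mul_I
  simp_rw [hterm]
  rw [Fintype.expect_const, norm_neg, norm_sgn]

lemma exists_labelledLaw_mem_alternatives [SecondCountableTopology H] {v : Option α → H}
    (hv : Orthonormal ℝ v) (b : α → ℤˣ) :
    ∃ ν ∈ referenceMeasures H, labelledLaw v b ∈ alternatives ν (1 / 4) := by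
  obtain ⟨ν, hν, hmass⟩ := exists_referenceMeasure_pair (labelDirection v b)
  have hp := hν.1
  have hP : IsProbabilityMeasure (labelledLaw v b) := isProbabilityMeasure_uniformLaw _
  refine ⟨ν, hν, hP, ?_⟩
  have hsign : ∀ w ∈ ({labelDirection v b, -labelDirection v b} : Set H),
      ∃ σ : ℤˣ, w = sgn σ • labelDirection v b := by
    rintro w (rfl | rfl)
    · exact ⟨1, by simp [sgn]⟩
    · exact ⟨-1, by simp [sgn]⟩
  have h := sq_measureReal_le_dCovSq ν (labelledLaw v b)
    (((Set.finite_singleton (-labelDirection v b)).insert (labelDirection v b)).measurableSet)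
    fun w₁ hw₁ w₂ hw₂ => by
      obtain ⟨σ, rfl⟩ := hsign w₁ hw₁
      obtain ⟨τ, rfl⟩ := hsign w₂ hw₂
      rw [charFun_fst_labelledLaw hv, zero_mul, sub_zero, norm_jointCharFun_labelledLaw hv]
  nlinarith

end HiddenLabels

/-! ### Error probabilities as averages -/

section Testing

variable {H : Type*} [MeasurableSpace H] {U : Type*} [MeasurableSpace U] {ι : Type*}
  [Fintype ι] [Nonempty ι] [MeasurableSpace ι] [DiscreteMeasurableSpace ι]

/-- Under a uniform law on finitely many points, the probability of an event is an average, over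
all samples of indices, of its conditional probability given the data. -/
lemma sampleLaw_uniformLaw_real (n : ℕ) (κ : Measure U) [IsProbabilityMeasure κ]
    (x : ι → H × H) {A : Set ((Fin n → H × H) × U)} (hA : MeasurableSet A) :
    (sampleLaw n (uniformLaw x) κ).real A
      = 𝔼 ω : Fin n → ι, κ.real (Prod.mk (fun k => x (ω k)) ⁻¹' A) := by
  rw [measureReal_def, sampleLaw, pi_uniformLaw, Measure.prod_apply hA,
    ← integral_toReal (measurable_measure_prodMk_left hA).aemeasurable
      (ae_of_all _ fun _ => measure_lt_top _ _),
    integral_uniformLaw _ (measurable_measure_prodMk_left hA).ennreal_toReal.stronglyMeasurable]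
  rfl

end Testing

end IndepTesting
end

/-! ### The lower bound -/

theorem mainTheorem4 {H : Type*} [NormedAddCommGroup H] [InnerProductSpace ℝ H]
    [CompleteSpace H] [TopologicalSpace.SeparableSpace H] [MeasurableSpace H] [BorelSpace H]
    (hdim : ¬ FiniteDimensional ℝ H)
    (α β : ℝ) (hα : 0 < α ∧ α < 1) (hβ : 0 < β ∧ β < 1) (hαβ : α + β < 1) :
    ∃ c : ℝ, 0 < c ∧ ∃ N : ℕ, ∀ n : ℕ, N ≤ n →
      ∀ (U : Type*) [MeasurableSpace U] (κ : Measure U) [IsProbabilityMeasure κ],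
        ENNReal.ofReal (c * (n : ℝ) ^ (-(1 / 2) : ℝ)) ≤ IndepTesting.minimaxRate H n κ α β := by
  have : SecondCountableTopology H := UniformSpace.secondCountable_of_separable H
  obtain ⟨v, hv⟩ := IndepTesting.exists_orthonormal_nat hdim
  -- The lower bound `1 / 4` holds for every `n`, and `1 / 4 * n ^ (-1 / 2)` is below it.
  refine ⟨1 / 4, by norm_num, 1, fun n hn U _ κ _ => ?_⟩
  refine le_iInf₂ fun ψ hψ => le_iInf₂ fun ρ hρ => ENNReal.ofReal_le_ofReal ?_
  have hn1 : (n : ℝ) ^ (-(1 / 2) : ℝ) ≤ 1 :=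
    Real.rpow_le_one_of_one_le_of_nonpos (by exact_mod_cast hn) (by norm_num)
  suffices h : 1 / 4 ≤ ρ by linarith
  by_contra! hlt
  -- Enough places that a collision is less likely than the slack left by the two errors.
  obtain ⟨M, hM, hcoll⟩ := IndepTesting.exists_collision_lt n (δ := 1 - α - β) (by linarith)
  have : NeZero M := ⟨hM.ne'⟩
  set u : Option (Fin M) → H := v ∘ Encodable.encode with hu
  have hortho : Orthonormal ℝ u := hv.comp _ Encodable.encode_injective
  have hA : ∀ i, MeasurableSet {ω | ψ.decision ω = i} := fun i =>
    ψ.measurable_decision (measurableSet_singleton i)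
  have hnull : 1 - α ≤ (IndepTesting.sampleLaw n (IndepTesting.independentLaw u) κ).real
      {ω | ψ.decision ω = 0} := by
    have hmem := IndepTesting.independentLaw_mem_nullLaws u
    have := hmem.1
    have : IsProbabilityMeasure (IndepTesting.sampleLaw n (IndepTesting.independentLaw u) κ) := by
      unfold IndepTesting.sampleLaw; infer_instance
    have h1 := ENNReal.toReal_le_of_le_ofReal hα.1.le ((le_iSup₂ (f := fun P _ =>
      IndepTesting.sampleLaw n P κ {ω | ψ.decision ω = 1}) _ hmem).trans hψ)
    have hcompl : {ω | ψ.decision ω = 0} = {ω | ψ.decision ω = 1}ᶜ := by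
      ext ω
      simp only [Set.mem_ofPred_eq, Set.mem_compl_iff]
      omega
    rw [hcompl, probReal_compl_eq_one_sub (hA 1), measureReal_def]
    linarith
  have halt : ∀ b : Fin M → ℤˣ,
      (IndepTesting.sampleLaw n (IndepTesting.labelledLaw u b) κ).real
        {ω | ψ.decision ω = 0} ≤ β := by
    intro b
    obtain ⟨ν, hν, hP, hd⟩ := IndepTesting.exists_labelledLaw_mem_alternatives hortho b
    have hmem : IndepTesting.labelledLaw u b ∈ IndepTesting.alternatives ν ρ :=
      ⟨hP, hlt.le.trans hd⟩
    refine ENNReal.toReal_le_of_le_ofReal hβ.1.le (le_trans ?_ hρ.2)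
    exact (le_iSup₂ (f := fun P _ => IndepTesting.sampleLaw n P κ {ω | ψ.decision ω = 0})
      _ hmem).trans (le_iSup₂ (f := fun ν _ => ⨆ P ∈ IndepTesting.alternatives ν ρ,
        IndepTesting.sampleLaw n P κ {ω | ψ.decision ω = 0}) ν hν)
  have hcmp := IndepTesting.expect_le_expect_labels_add (α := Fin M) (A := ℤˣ)
    (fun ω : Fin n → Fin M × ℤˣ × ℤˣ => κ.real
      (Prod.mk (fun k => IndepTesting.signedPair u (ω k)) ⁻¹' {ω | ψ.decision ω = 0}))
    (fun _ => measureReal_nonneg) (fun _ => measureReal_le_one)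
  rw [← IndepTesting.sampleLaw_uniformLaw_real n κ (IndepTesting.signedPair u) (hA 0),
    Fintype.card_fin] at hcmp
  have havg : (Finset.univ.expect fun b : Fin M → ℤˣ => Finset.univ.expect
      fun ω : Fin n → Fin M × ℤˣ => κ.real (Prod.mk (fun k => IndepTesting.signedPair u
        ((ω k).1, (ω k).2, (ω k).2 * b (ω k).1)) ⁻¹' {ω | ψ.decision ω = 0})) ≤ β := by
    refine Finset.expect_le Finset.univ_nonempty fun b _ => ?_
    rw [← IndepTesting.sampleLaw_uniformLaw_real n κ (fun p : Fin M × ℤˣ =>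
      IndepTesting.signedPair u (p.1, p.2, p.2 * b p.1)) (hA 0)]
    exact halt b
  rw [IndepTesting.independentLaw] at hnull
  linarith
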